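/- Let $k$ be an algebraically closed field (of any characteristic), and let $r,n$ be integers with $1\le r\le n-2$ and $n\ge 5$. Let $\mathbb{G}(r,n)\subset\mathbb{P}^N$, $N=\binom{n+1}{r+1}-1$, be the Grassmannian of $r$-dimensional linear subspaces of $\mathbb{P}^n$ in its Plücker embedding. For a smooth, irreducible, non-degenerate projective variety $X\subset\mathbb{P}^N$, the $2$-Terracini locus $T_2(X)$ is the Zariski closure in $X^2/S_2=(X\times X)/S_2$ of $$\{\{x_1,x_2\} \mid x_1,x_2\in X,\ x_1\ne x_2,\ \dim\langle T_{x_1}X,T_{x_2}X\rangle<\min\{2\dim X+1,\,N\}\},$$ where $T_xX\subset\mathbb{P}^N$ is the embedded projective tangent space of $X$ at $x$. Then $T_2(\mathbb{G}(r,n))$ is the closure of $$\{([U],[U'])\in\mathbb{G}(r,n)\times\mathbb{G}(r,n)\mid U\ne U'\text{ and }\dim(U\cap U')\ge r-2\}/S_2$$ in $(\mathbb{G}(r,n)\times\mathbb{G}(r,n))/S_2$, where dimensions are projective and $\dim\emptyset=-1$. -/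

import Mathlib

open scoped LinearAlgebra.Projectivization

noncomputable section

namespace Terracini

section General

variable {K ι : Type*} [Field K] [Fintype ι]

/-- The affine cone, without its vertex, over a set of points of the projective space
`ℙ K (ι → K)`, whose homogeneous coordinates are indexed by `ι`. -/
def cone (X : Set (ℙ K (ι → K))) : Set (ι → K) :=
  {v | ∃ h : v ≠ 0, Projectivization.mk K v h ∈ X}

/-- The ideal `I(X)` of all polynomials that vanish on the cone over `X`. -/
def coneIdeal (X : Set (ℙ K (ι → K))) : Ideal (MvPolynomial ι K) :=
  MvPolynomial.vanishingIdeal K (cone X)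

/-- The homogeneous coordinate ring `K[x_j : j ∈ ι] / I(X)`. -/
abbrev CoordRing (X : Set (ℙ K (ι → K))) : Type _ :=
  MvPolynomial ι K ⧸ coneIdeal X

/-- The dimension of a projective variety: the transcendence degree over `K` of its homogeneous
coordinate ring, minus one. -/
def dim (X : Set (ℙ K (ι → K))) : ℕ :=
  Cardinal.toNat (Algebra.trdeg K (CoordRing X)) - 1

/-- The embedded projective tangent space `T_x X`, given as a linear subspace of `K^ι`: the common
kernel of the differentials at `x` of all the polynomials in `I(X)`. Its dimension as a projective
space is its linear dimension minus one. -/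
def tangentSpace (X : Set (ℙ K (ι → K))) (x : ℙ K (ι → K)) : Submodule K (ι → K) where
  carrier := {v | ∀ F ∈ coneIdeal X,
    ∑ j, MvPolynomial.eval x.rep (MvPolynomial.pderiv j F) * v j = 0}
  add_mem' := by
    intro v w hv hw F hF
    simp [mul_add, Finset.sum_add_distrib, hv F hF, hw F hF]
  zero_mem' := by
    intro F _
    simp
  smul_mem' := by
    intro c v hv F hF
    have h : ∑ j, MvPolynomial.eval x.rep (MvPolynomial.pderiv j F) * (c • v) j
        = c * ∑ j, MvPolynomial.eval x.rep (MvPolynomial.pderiv j F) * v j := by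
      rw [Finset.mul_sum]
      refine Finset.sum_congr rfl fun j _ => ?_
      simp only [Pi.smul_apply, smul_eq_mul]
      ring
    rw [h, hv F hF, mul_zero]

/-- A polynomial in `h` groups of variables `x_{i,j}` is multihomogeneous of multidegree `d` if it
is homogeneous of degree `d i` in the `i`-th group, for every `i`. -/
def IsMultihomogeneous {h : ℕ} (F : MvPolynomial (Fin h × ι) K) (d : Fin h → ℕ) : Prop :=
  MvPolynomial.IsWeightedHomogeneous
    (fun p : Fin h × ι => (Pi.single p.1 1 : Fin h → ℕ)) F d

/-- The Zariski topology on the `h`-fold product of the projective space with itself, as an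
algebraic variety: the nonvanishing sets of the multihomogeneous polynomials are a basis of open
sets. -/
@[reducible] def zariskiTopology (K ι : Type*) [Field K] [Fintype ι] (h : ℕ) :
    TopologicalSpace (Fin h → ℙ K (ι → K)) :=
  TopologicalSpace.generateFrom
    {U | ∃ (F : MvPolynomial (Fin h × ι) K) (d : Fin h → ℕ), IsMultihomogeneous F d ∧
      U = {x | MvPolynomial.eval (fun p : Fin h × ι => (x p.1).rep p.2) F ≠ 0}}

/-- Two `h`-tuples are equivalent if they differ by a permutation of the entries. -/
def permSetoid (h : ℕ) (α : Type*) : Setoid (Fin h → α) where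
  r x y := ∃ σ : Equiv.Perm (Fin h), y = x ∘ σ
  iseqv :=
    { refl := fun x => ⟨1, rfl⟩
      symm := by
        rintro x y ⟨σ, rfl⟩
        exact ⟨σ⁻¹, by funext i; simp⟩
      trans := by
        rintro x y z ⟨σ, rfl⟩ ⟨τ, rfl⟩
        exact ⟨σ * τ, rfl⟩ }

/-- The symmetric product `X^h / S_h`. -/
def SymProd (h : ℕ) (X : Set (ℙ K (ι → K))) : Type _ :=
  Quotient (permSetoid h X)

/-- The unordered `h`-tuple `{x_1, …, x_h}` of points of `X`. -/
def SymProd.mk {h : ℕ} {X : Set (ℙ K (ι → K))} (x : Fin h → X) : SymProd h X :=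
  Quotient.mk (permSetoid h X) x

/-- The Zariski topology on `X^h / S_h`: the quotient of the subspace topology on `X^h`. -/
instance (h : ℕ) (X : Set (ℙ K (ι → K))) : TopologicalSpace (SymProd h X) :=
  TopologicalSpace.coinduced SymProd.mk
    (TopologicalSpace.induced (fun (x : Fin h → X) i => (x i : ℙ K (ι → K)))
      (zariskiTopology K ι h))

/-- The set `T_h(X)°` of the unordered `h`-tuples of distinct points of `X` whose tangent spaces
span a projective space of dimension less than `min {h * dim X + h - 1, N}`, where
`N = #ι - 1` is the dimension of the ambient projective space. -/
def terraciniOpen (h : ℕ) (X : Set (ℙ K (ι → K))) : Set (SymProd h X) :=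
  {p | ∃ x : Fin h → X, p = SymProd.mk x ∧ Function.Injective x ∧
    (Module.finrank K ↥(⨆ i, tangentSpace X (x i)) : ℤ) - 1 <
      min ((h : ℤ) * (dim X : ℤ) + h - 1) ((Fintype.card ι : ℤ) - 1)}

/-- The `h`-th Terracini locus `T_h(X)`: the closure of `T_h(X)°` in `X^h / S_h`. -/
def terraciniLocus (h : ℕ) (X : Set (ℙ K (ι → K))) : Set (SymProd h X) :=
  closure (terraciniOpen h X)

end General

section Grassmannian

variable {K : Type*} [Field K]

/-- The `r`-dimensional linear subspaces of `ℙ^n`, i.e. the linear subspaces of dimension `r + 1`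
of `K^(n+1)`. -/
def Gr (K : Type*) [Field K] (r n : ℕ) : Type _ :=
  {U : Submodule K (Fin (n + 1) → K) // Module.finrank K U = r + 1}

/-- The vector of the maximal minors of a `k × m` matrix, indexed by the increasing sequences
of `k` columns. -/
def minors {k m : ℕ} (M : Matrix (Fin k) (Fin m) K) : (Fin k ↪o Fin m) → K :=
  fun I => (M.submatrix id I).det

theorem minors_ne_zero {k m : ℕ} (M : Matrix (Fin k) (Fin m) K)
    (hM : LinearIndependent K M.row) : minors M ≠ 0 := by
  classical
  have hrank : M.rank = k := by
    simpa using hM.rank_matrix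
  obtain ⟨κ, a, ha, hspan, hli⟩ := exists_linearIndependent' K M.col
  have hfin : Finite κ := Finite.of_injective a ha
  have : Fintype κ := Fintype.ofFinite κ
  have hcard : Fintype.card κ = k := by
    rw [← hrank, Matrix.rank_eq_finrank_span_cols, ← hspan]
    exact (finrank_span_eq_card hli).symm
  let S : Finset (Fin m) := Finset.univ.image a
  have hS : S.card = k := by
    rw [Finset.card_image_of_injective _ ha, Finset.card_univ, hcard]
  let I : Fin k ↪o Fin m := S.orderEmbOfFin hS
  have hmem : ∀ i, ∃ c, a c = I i := fun i => by
    have hI : I i ∈ S := S.orderEmbOfFin_mem hS i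
    obtain ⟨c, -, hc⟩ := Finset.mem_image.mp hI
    exact ⟨c, hc⟩
  choose c hc using hmem
  have hcinj : Function.Injective c := fun i j hij => by
    apply I.injective
    rw [← hc i, ← hc j, hij]
  have hli2 : LinearIndependent K (M.submatrix id I).col := by
    have h1 := hli.comp c hcinj
    have h2 : (M.col ∘ a) ∘ c = (M.submatrix id I).col := by
      funext i j
      simp [hc]
    rwa [h2] at h1
  have hu := Matrix.linearIndependent_cols_iff_isUnit.mp hli2
  intro h0
  have h3 : (M.submatrix id I).det = 0 := congrFun h0 I
  exact ((Matrix.isUnit_iff_isUnit_det _).mp hu).ne_zero h3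

/-- A matrix whose rows are a basis of `U`. -/
def basisMatrix {r n : ℕ} (U : Gr K r n) : Matrix (Fin (r + 1)) (Fin (n + 1)) K :=
  fun i => (Module.finBasisOfFinrankEq K U.1 U.2 i : Fin (n + 1) → K)

theorem linearIndependent_basisMatrix {r n : ℕ} (U : Gr K r n) :
    LinearIndependent K (basisMatrix U).row :=
  (Module.finBasisOfFinrankEq K U.1 U.2).linearIndependent.map' U.1.subtype
    (Submodule.ker_subtype _)

/-- The Plücker embedding: `[U]` is the point of `ℙ^N`, `N = (n+1 choose r+1) - 1`, whose
homogeneous coordinates are the maximal minors of a matrix whose rows are a basis of `U`. Another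
basis multiplies all the coordinates by one nonzero constant, and so gives the same point. -/
def plucker {r n : ℕ} (U : Gr K r n) : ℙ K ((Fin (r + 1) ↪o Fin (n + 1)) → K) :=
  Projectivization.mk K (minors (basisMatrix U))
    (minors_ne_zero _ (linearIndependent_basisMatrix U))

/-- The Grassmannian `𝔾(r, n)` in its Plücker embedding. -/
def grassmannian (K : Type*) [Field K] (r n : ℕ) :
    Set (ℙ K ((Fin (r + 1) ↪o Fin (n + 1)) → K)) :=
  Set.range plucker

/-- The point `[U]` of the Plücker-embedded Grassmannian. -/
def Gr.point {r n : ℕ} (U : Gr K r n) : grassmannian K r n :=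
  ⟨plucker U, U, rfl⟩

end Grassmannian

end Terracini

end

noncomputable section

namespace Terracini

/-! ### Tangent spaces via dual numbers -/

section TangentSpace

variable {K ι : Type*} [Field K] [Fintype ι]

/-- The tangent space, at a vector `x`, of the common zero set of the polynomials vanishing
on `C`. -/
def tangentVec (C : Set (ι → K)) (x : ι → K) : Submodule K (ι → K) where
  carrier := {v | ∀ F ∈ MvPolynomial.vanishingIdeal K C,
    ∑ j, MvPolynomial.eval x (MvPolynomial.pderiv j F) * v j = 0}
  add_mem' := by
    intro v w hv hw F hF
    simp [mul_add, Finset.sum_add_distrib, hv F hF, hw F hF]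
  zero_mem' := by
    intro F _
    simp
  smul_mem' := by
    intro c v hv F hF
    have h := hv F hF
    simp only [Pi.smul_apply, smul_eq_mul, mul_left_comm _ c]
    rw [← Finset.mul_sum, h, mul_zero]

theorem tangentSpace_eq_tangentVec (X : Set (ℙ K (ι → K))) (x : ℙ K (ι → K)) :
    tangentSpace X x = tangentVec (cone X) x.rep := rfl

/-- The point `x + ε v` with coordinates in the dual numbers. -/
def dualPoint (x v : ι → K) : ι → DualNumber K :=
  fun j => TrivSqZeroExt.inl (x j) + TrivSqZeroExt.inr (v j)

/-- First-order Taylor expansion. Tangency becomes the vanishing of an `ε`-part, so that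
substitution replaces the chain rule. -/
theorem aeval_dualPoint (x v : ι → K) (F : MvPolynomial ι K) :
    MvPolynomial.aeval (dualPoint x v) F =
      TrivSqZeroExt.inl (MvPolynomial.eval x F) +
        TrivSqZeroExt.inr (∑ j, MvPolynomial.eval x (MvPolynomial.pderiv j F) * v j) := by
  classical
  induction F using MvPolynomial.induction_on with
  | C a => ext <;> simp [TrivSqZeroExt.algebraMap_eq_inl]
  | add p q hp hq =>
    rw [map_add, hp, hq]
    ext <;> simp [add_mul, Finset.sum_add_distrib]
  | mul_X p i hp =>
    rw [map_mul, hp, MvPolynomial.aeval_X]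
    have h : ∑ j, MvPolynomial.eval x (MvPolynomial.pderiv j (p * MvPolynomial.X i)) * v j =
        MvPolynomial.eval x p * v i +
          x i * ∑ j, MvPolynomial.eval x (MvPolynomial.pderiv j p) * v j := by
      have h1 : ∀ j, MvPolynomial.eval x (MvPolynomial.pderiv j (p * MvPolynomial.X i)) * v j =
          (if j = i then MvPolynomial.eval x p * v i else 0) +
            x i * (MvPolynomial.eval x (MvPolynomial.pderiv j p) * v j) := by
        intro j
        by_cases hj : j = i
        · subst hj
          simp [Derivation.leibniz]
          ring
        · simp [Derivation.leibniz, MvPolynomial.pderiv_X_of_ne (Ne.symm hj), hj]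
          ring
      rw [Finset.sum_congr rfl fun j _ => h1 j, Finset.sum_add_distrib, Finset.mul_sum]
      simp
    rw [h]
    ext <;> simp [dualPoint, mul_comm (x i)]

theorem mem_tangentVec_iff {C : Set (ι → K)} {x v : ι → K} :
    v ∈ tangentVec C x ↔ ∀ F ∈ MvPolynomial.vanishingIdeal K C,
      (MvPolynomial.aeval (dualPoint x v) F).snd = 0 := by
  simp only [aeval_dualPoint, TrivSqZeroExt.snd_add, TrivSqZeroExt.snd_inl,
    TrivSqZeroExt.snd_inr, zero_add]
  rfl

/-- Linear substitution of the variables of a polynomial. -/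
def linSubst (L : (ι → K) →ₗ[K] (ι → K)) : MvPolynomial ι K →ₐ[K] MvPolynomial ι K :=
  open scoped Classical in
  MvPolynomial.aeval fun j => ∑ i, MvPolynomial.C (L (Pi.single i 1) j) * MvPolynomial.X i

theorem linMap_apply_eq_sum [DecidableEq ι] (L : (ι → K) →ₗ[K] (ι → K)) (x : ι → K) (j : ι) :
    L x j = ∑ i, L (Pi.single i 1) j * x i := by
  conv_lhs => rw [LinearMap.pi_apply_eq_sum_univ L x]
  simp only [Finset.sum_apply, Pi.smul_apply, smul_eq_mul]
  refine Finset.sum_congr rfl fun i _ => ?_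
  rw [mul_comm]
  have h : (fun t => if i = t then (1 : K) else 0) = Pi.single i 1 := by
    funext t
    simp [Pi.single_apply, eq_comm]
  rw [h]

theorem aeval_linSubst (L : (ι → K) →ₗ[K] (ι → K)) (x : ι → K) (F : MvPolynomial ι K) :
    MvPolynomial.aeval x (linSubst L F) = MvPolynomial.aeval (L x) F := by
  classical
  have : (MvPolynomial.aeval x).comp (linSubst L) = MvPolynomial.aeval (R := K) (L x) := by
    ext j
    simp [linSubst, linMap_apply_eq_sum L x j]
  exact DFunLike.congr_fun this F

theorem aeval_dualPoint_linSubst (L : (ι → K) →ₗ[K] (ι → K)) (x v : ι → K)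
    (F : MvPolynomial ι K) :
    MvPolynomial.aeval (dualPoint x v) (linSubst L F) =
      MvPolynomial.aeval (dualPoint (L x) (L v)) F := by
  classical
  have : (MvPolynomial.aeval (dualPoint x v)).comp (linSubst L) =
      MvPolynomial.aeval (R := K) (dualPoint (L x) (L v)) := by
    apply MvPolynomial.algHom_ext
    intro j
    simp only [AlgHom.comp_apply, linSubst, MvPolynomial.aeval_X, map_sum, map_mul,
      MvPolynomial.aeval_C, TrivSqZeroExt.algebraMap_eq_inl, dualPoint,
      linMap_apply_eq_sum L x j, linMap_apply_eq_sum L v j, TrivSqZeroExt.inl_sum,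
      TrivSqZeroExt.inr_sum, ← Finset.sum_add_distrib]
    refine Finset.sum_congr rfl fun i _ => ?_
    ext <;> simp
  exact DFunLike.congr_fun this F

/-- Substituting `L` into a polynomial vanishing on `C` gives another such polynomial, and
dual-number points transform along. -/
theorem map_mem_tangentVec {C : Set (ι → K)} (L : (ι → K) →ₗ[K] (ι → K))
    (hL : ∀ x ∈ C, L x ∈ C) {x v : ι → K} (hv : v ∈ tangentVec C x) :
    L v ∈ tangentVec C (L x) := by
  rw [mem_tangentVec_iff] at hv ⊢
  intro F hF
  rw [← aeval_dualPoint_linSubst]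
  refine hv _ ?_
  rw [MvPolynomial.mem_vanishingIdeal_iff] at hF ⊢
  intro y hy
  rw [aeval_linSubst]
  exact hF _ (hL y hy)

theorem tangentVec_map {C : Set (ι → K)} (L : (ι → K) ≃ₗ[K] (ι → K))
    (hL : ∀ x ∈ C, L x ∈ C) (hL' : ∀ x ∈ C, L.symm x ∈ C) (x : ι → K) :
    tangentVec C (L x) = (tangentVec C x).map (L : (ι → K) →ₗ[K] (ι → K)) := by
  apply le_antisymm
  · intro v hv
    refine ⟨L.symm v, ?_, by simp⟩
    simpa using map_mem_tangentVec (L.symm : (ι → K) →ₗ[K] (ι → K)) hL' hv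
  · rintro _ ⟨v, hv, rfl⟩
    exact map_mem_tangentVec (L : (ι → K) →ₗ[K] (ι → K)) hL hv

theorem tangentVec_smul {C : Set (ι → K)} (hC : ∀ c : K, c ≠ 0 → ∀ x ∈ C, c • x ∈ C)
    {c : K} (hc : c ≠ 0) (x : ι → K) : tangentVec C (c • x) = tangentVec C x := by
  have key : ∀ (c : K), c ≠ 0 → ∀ x, tangentVec C x ≤ tangentVec C (c • x) := by
    intro c hc x v hv
    have := map_mem_tangentVec (c • LinearMap.id) (by simpa using hC c hc) hv
    simp only [LinearMap.smul_apply, LinearMap.id_apply] at this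
    exact (Submodule.smul_mem_iff _ hc).mp this
  refine le_antisymm ?_ (key c hc x)
  simpa [smul_smul, hc] using key c⁻¹ (inv_ne_zero hc) (c • x)

/-- If a line `x + t v` meets `C` in all but finitely many of its points, then `v` is a tangent
vector at `x`. -/
theorem mem_tangentVec_of_line [Infinite K] {C : Set (ι → K)} {x v : ι → K}
    (h : {t : K | x + t • v ∈ C}.Infinite) : v ∈ tangentVec C x := by
  rw [mem_tangentVec_iff]
  intro F hF
  let f : Polynomial K :=
    MvPolynomial.aeval (fun j => Polynomial.C (x j) + Polynomial.X * Polynomial.C (v j)) F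
  have hf : f = 0 := by
    refine Polynomial.eq_zero_of_infinite_isRoot f (h.mono ?_)
    intro t ht
    have h1 : f.eval t = MvPolynomial.aeval (x + t • v) F := by
      have : (Polynomial.aeval t).comp (MvPolynomial.aeval
          (fun j => Polynomial.C (x j) + Polynomial.X * Polynomial.C (v j))) =
          MvPolynomial.aeval (R := K) (x + t • v) := by
        apply MvPolynomial.algHom_ext
        intro j
        simp
        ring
      rw [← this, AlgHom.comp_apply, Polynomial.coe_aeval_eq_eval]
    change f.eval t = 0
    rw [h1]
    exact (MvPolynomial.mem_vanishingIdeal_iff.mp hF) _ ht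
  -- Setting the parameter of the line to `ε` turns `f` into the value of `F` at `x + ε v`.
  have h2 : MvPolynomial.aeval (dualPoint x v) F =
      Polynomial.aeval (DualNumber.eps : DualNumber K) f := by
    have : (Polynomial.aeval (DualNumber.eps : DualNumber K)).comp (MvPolynomial.aeval
          (fun j => Polynomial.C (x j) + Polynomial.X * Polynomial.C (v j))) =
          MvPolynomial.aeval (R := K) (dualPoint x v) := by
      apply MvPolynomial.algHom_ext
      intro j
      ext <;> simp [dualPoint, TrivSqZeroExt.algebraMap_eq_inl]
    exact (DFunLike.congr_fun this F).symm
  rw [h2, hf]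
  simp

end TangentSpace

/-! ### Relations between maximal minors -/

section Minors

variable {k m : ℕ}

/-- The set of the entries of an increasing sequence. -/
def supp (J : Fin k ↪o Fin m) : Finset (Fin m) := Finset.univ.map J.toEmbedding

theorem mem_supp {J : Fin k ↪o Fin m} {x : Fin m} : x ∈ supp J ↔ ∃ i, J i = x := by
  simp [supp]

theorem card_supp (J : Fin k ↪o Fin m) : (supp J).card = k := by simp [supp]

theorem coe_supp (J : Fin k ↪o Fin m) : (supp J : Set (Fin m)) = Set.range J := by
  ext x
  simp [mem_supp]

theorem supp_injective : Function.Injective (supp : (Fin k ↪o Fin m) → Finset (Fin m)) := by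
  intro I J h
  rw [← OrderEmbedding.range_inj, ← coe_supp, ← coe_supp, h]

theorem exists_supp_eq {s : Finset (Fin m)} (hs : s.card = k) :
    ∃ J : Fin k ↪o Fin m, supp J = s :=
  ⟨s.orderEmbOfFin hs, by
    apply Finset.coe_injective
    rw [coe_supp, Finset.range_orderEmbOfFin]⟩

theorem exists_perm_of_range_eq {a : Fin k → Fin m} (ha : Function.Injective a)
    {J : Fin k ↪o Fin m} (h : Finset.univ.image a = supp J) :
    ∃ σ : Equiv.Perm (Fin k), a = J ∘ σ := by
  have h1 : ∀ i, ∃ j, J j = a i := fun i => by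
    rw [← mem_supp, ← h]
    exact Finset.mem_image_of_mem a (Finset.mem_univ i)
  choose σ hσ using h1
  have hinj : Function.Injective σ := fun i j hij => ha (by rw [← hσ, ← hσ, hij])
  exact ⟨Equiv.ofBijective σ (Finite.injective_iff_bijective.mp hinj), funext fun i => (hσ i).symm⟩

theorem exists_sort {a : Fin k → Fin m} (ha : Function.Injective a) :
    ∃ (J : Fin k ↪o Fin m) (σ : Equiv.Perm (Fin k)), a = J ∘ σ := by
  obtain ⟨J, hJ⟩ := exists_supp_eq (s := Finset.univ.image a) (k := k)
    (by rw [Finset.card_image_of_injective _ ha, Finset.card_univ, Fintype.card_fin])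
  exact ⟨J, exists_perm_of_range_eq ha hJ.symm⟩

theorem supp_eq_of_comp {a : Fin k → Fin m} {J : Fin k ↪o Fin m} {σ : Equiv.Perm (Fin k)}
    (h : a = J ∘ σ) : Finset.univ.image a = supp J := by
  subst h
  ext x
  simp only [Finset.mem_image, Finset.mem_univ, true_and, mem_supp, Function.comp_apply]
  exact ⟨fun ⟨i, hi⟩ => ⟨_, hi⟩, fun ⟨i, hi⟩ => ⟨σ.symm i, by simpa⟩⟩

variable {A B : Type*} [CommRing A] [CommRing B]

open scoped Classical in
/-- The extension of a family indexed by increasing sequences to an alternating family indexed by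
all sequences. -/
def altExt (p : (Fin k ↪o Fin m) → A) (a : Fin k → Fin m) : A :=
  if h : Function.Injective a then
    ((Equiv.Perm.sign (exists_sort h).choose_spec.choose : ℤ) : A) * p (exists_sort h).choose
  else 0

/-- The value does not depend on the chosen sorting: the set of entries determines `J`, and
injectivity of `J` then determines `σ`. -/
theorem altExt_comp (p : (Fin k ↪o Fin m) → A) (J : Fin k ↪o Fin m) (σ : Equiv.Perm (Fin k)) :
    altExt p (J ∘ σ) = ((Equiv.Perm.sign σ : ℤ) : A) * p J := by
  have h : Function.Injective (J ∘ σ) := J.injective.comp σ.injective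
  rw [altExt, dif_pos h]
  have key : ∀ (J' : Fin k ↪o Fin m) (τ : Equiv.Perm (Fin k)), J ∘ σ = J' ∘ τ →
      ((Equiv.Perm.sign τ : ℤ) : A) * p J' = ((Equiv.Perm.sign σ : ℤ) : A) * p J := by
    intro J' τ h'
    obtain rfl : J = J' :=
      supp_injective ((supp_eq_of_comp rfl).symm.trans (supp_eq_of_comp h'))
    obtain rfl : σ = τ := Equiv.ext fun i => J.injective (congrFun h' i)
    rfl
  exact key _ _ (exists_sort h).choose_spec.choose_spec

theorem altExt_self (p : (Fin k ↪o Fin m) → A) (J : Fin k ↪o Fin m) : altExt p J = p J := by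
  simpa using altExt_comp p J 1

theorem altExt_of_not_injective (p : (Fin k ↪o Fin m) → A) {a : Fin k → Fin m}
    (ha : ¬ Function.Injective a) : altExt p a = 0 := dif_neg ha

theorem map_altExt (f : A →+* B) (p : (Fin k ↪o Fin m) → A) (a : Fin k → Fin m) :
    f (altExt p a) = altExt (fun J => f (p J)) a := by
  by_cases ha : Function.Injective a
  · obtain ⟨J, σ, rfl⟩ := exists_sort ha
    simp [altExt_comp]
  · simp [altExt_of_not_injective _ ha]

theorem altExt_minors (M : Matrix (Fin k) (Fin m) A) (a : Fin k → Fin m) :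
    altExt (fun J => (M.submatrix id J).det) a = (M.submatrix id a).det := by
  by_cases ha : Function.Injective a
  · obtain ⟨J, σ, rfl⟩ := exists_sort ha
    rw [altExt_comp, ← Matrix.det_permute' σ]
    rfl
  · rw [altExt_of_not_injective _ ha]
    simp only [Function.Injective, not_forall] at ha
    obtain ⟨i, j, hij, hne⟩ := ha
    exact (Matrix.det_zero_of_column_eq hne fun t => by simp [hij]).symm

/-- The matrix whose entries are the coordinates `p_a`, for the sequences `a` obtained from `I` by
replacing one entry. -/
def nearMatrix (I : Fin k ↪o Fin m) (p : (Fin k ↪o Fin m) → A) : Matrix (Fin k) (Fin m) A :=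
  Matrix.of fun i j => altExt p (Function.update I i j)

theorem map_nearMatrix (f : A →+* B) (I : Fin k ↪o Fin m) (p : (Fin k ↪o Fin m) → A) :
    (nearMatrix I p).map f = nearMatrix I (fun J => f (p J)) := by
  ext i j
  simp [nearMatrix, map_altExt]

theorem submatrix_update_eq {R : Type*} (M : Matrix (Fin k) (Fin m) R) (a : Fin k → Fin m) (i : Fin k)
    (j : Fin m) :
    M.submatrix id (Function.update a i j) = (M.submatrix id a).updateCol i (fun t => M t j) := by
  ext s t
  by_cases h : t = i
  · subst h
    simp
  · simp [h]

/-- Cramer's rule: replacing column `i` of the block `M_I` by column `j` of `M` computes an entry of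
`adj(M_I) M`. -/
theorem nearMatrix_minors (I : Fin k ↪o Fin m) (M : Matrix (Fin k) (Fin m) A) :
    nearMatrix I (fun J => (M.submatrix id J).det) = (M.submatrix id I).adjugate * M := by
  ext i j
  have h : ((M.submatrix id I).adjugate * M) i j =
      (M.submatrix id I).cramer (fun t => M t j) i := by
    rw [Matrix.cramer_eq_adjugate_mulVec]
    rfl
  rw [h, Matrix.cramer_apply, nearMatrix, Matrix.of_apply, altExt_minors, submatrix_update_eq]

/-- The relation between the maximal minors of a matrix that expresses all of them by those that
differ from `I` in at most one column. -/
theorem det_nearMatrix_minors (I J : Fin k ↪o Fin m) (M : Matrix (Fin k) (Fin m) A) :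
    ((nearMatrix I (fun J => (M.submatrix id J).det)).submatrix id J).det =
      (M.submatrix id I).det ^ (k - 1) * (M.submatrix id J).det := by
  rw [nearMatrix_minors, Matrix.submatrix_mul _ _ id id J Function.bijective_id, Matrix.det_mul]
  simp [Matrix.det_adjugate]

theorem det_submatrix_update_of_eq_one {M : Matrix (Fin k) (Fin m) A} {I : Fin k ↪o Fin m}
    (hM : M.submatrix id I = 1) (i : Fin k) (j : Fin m) :
    (M.submatrix id (Function.update I i j)).det = M i j := by
  rw [submatrix_update_eq, hM, ← Matrix.cramer_apply, Matrix.cramer_one]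
  rfl

theorem not_injective_update {I : Fin k ↪o Fin m} {i t : Fin k} (h : t ≠ i) :
    ¬ Function.Injective (Function.update I i (I t)) := fun hinj =>
  h (hinj (by simp [h]))

theorem nearMatrix_submatrix_self (I : Fin k ↪o Fin m) (p : (Fin k ↪o Fin m) → A) :
    (nearMatrix I p).submatrix id I = p I • (1 : Matrix (Fin k) (Fin k) A) := by
  ext i t
  by_cases h : t = i
  · subst h
    simp [nearMatrix, altExt_self]
  · rw [Matrix.submatrix_apply, nearMatrix, Matrix.of_apply, id,
      altExt_of_not_injective _ (not_injective_update h)]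
    simp [Matrix.one_apply_ne (Ne.symm h)]

/-- `J` has at most one entry that is not an entry of `I`. -/
def Near (I J : Fin k ↪o Fin m) : Prop := (supp J \ supp I).card ≤ 1

theorem near_of_update {I J : Fin k ↪o Fin m} {i : Fin k} {j : Fin m} {σ : Equiv.Perm (Fin k)}
    (h : Function.update I i j = J ∘ σ) : Near I J := by
  refine (Finset.card_le_card (t := {j}) ?_).trans (by simp)
  rw [← supp_eq_of_comp h]
  intro x hx
  simp only [Finset.mem_sdiff, Finset.mem_image, Finset.mem_univ, true_and, mem_supp] at hx
  obtain ⟨⟨t, rfl⟩, h2⟩ := hx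
  by_cases ht : t = i
  · simp [ht]
  · exact absurd ⟨t, by simp [ht]⟩ h2

theorem Near.exists_update [NeZero k] {I J : Fin k ↪o Fin m} (h : Near I J) :
    ∃ (i : Fin k) (j : Fin m) (σ : Equiv.Perm (Fin k)), Function.update I i j = J ∘ σ := by
  rcases Nat.lt_or_ge (supp J \ supp I).card 1 with h0 | h0
  · have h1 : supp J ⊆ supp I := by
      rw [← Finset.sdiff_eq_empty_iff_subset, ← Finset.card_eq_zero]
      omega
    have h2 : I = J := (supp_injective (Finset.eq_of_subset_of_card_le h1 (by simp [card_supp]))).symm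
    subst h2
    -- For `J = I` an entry is replaced by itself, which needs `k > 0`.
    exact ⟨0, I 0, 1, by simp⟩
  · have hcard : (supp J \ supp I).card = 1 := le_antisymm h h0
    have hcard' : (supp I \ supp J).card = 1 := by
      rw [← hcard]
      exact Finset.card_sdiff_comm (by simp [card_supp])
    obtain ⟨j, hj⟩ := Finset.card_eq_one.mp hcard
    obtain ⟨x, hx⟩ := Finset.card_eq_one.mp hcard'
    have hjm : j ∈ supp J \ supp I := by simp [hj]
    have hxm : x ∈ supp I \ supp J := by simp [hx]
    rw [Finset.mem_sdiff] at hjm hxm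
    obtain ⟨i, rfl⟩ := mem_supp.mp hxm.1
    have hinj : Function.Injective (Function.update I i j) := by
      intro s t hst
      have hjI : ∀ s, I s ≠ j := fun s hs => hjm.2 (mem_supp.mpr ⟨s, hs⟩)
      by_cases hs : s = i <;> by_cases ht : t = i
      · rw [hs, ht]
      · simp only [hs, Function.update_self, Function.update_of_ne ht] at hst
        exact absurd hst.symm (hjI t)
      · simp only [ht, Function.update_self, Function.update_of_ne hs] at hst
        exact absurd hst (hjI s)
      · simp only [Function.update_of_ne ht, Function.update_of_ne hs] at hst
        exact I.injective hst
    obtain ⟨σ, hσ⟩ := exists_perm_of_range_eq hinj (J := J) (by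
      apply Finset.eq_of_subset_of_card_le
      · intro y hy
        simp only [Finset.mem_image, Finset.mem_univ, true_and] at hy
        obtain ⟨t, rfl⟩ := hy
        by_cases ht : t = i
        · simpa [ht] using hjm.1
        · rw [Function.update_of_ne ht]
          by_contra hn
          have : I t ∈ supp I \ supp J := Finset.mem_sdiff.mpr ⟨mem_supp.mpr ⟨t, rfl⟩, hn⟩
          rw [hx, Finset.mem_singleton] at this
          exact ht (I.injective this)
      · rw [card_supp, Finset.card_image_of_injective _ hinj]
        simp)
    exact ⟨i, j, σ, hσ⟩

/-- The matrix whose rows are the coordinate vectors listed by `a`. -/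
def coordMatrix (A : Type*) [CommRing A] (a : Fin k → Fin m) : Matrix (Fin k) (Fin m) A :=
  Matrix.of fun i => Pi.single (a i) 1

theorem det_coordMatrix (J J' : Fin k ↪o Fin m) :
    ((coordMatrix A J).submatrix id J').det = (Pi.single J 1 : (Fin k ↪o Fin m) → A) J' := by
  by_cases h : J' = J
  · subst h
    rw [Pi.single_eq_same, ← Matrix.det_one (R := A) (n := Fin k)]
    congr 1
    ext i j
    simp [coordMatrix, Matrix.one_apply, Pi.single_apply, eq_comm]
  · rw [Pi.single_eq_of_ne h]
    have h1 : ∃ t, J' t ∉ supp J := by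
      by_contra hn
      push Not at hn
      refine h (supp_injective (Finset.eq_of_subset_of_card_le ?_ (by simp [card_supp])))
      intro x hx
      obtain ⟨t, rfl⟩ := mem_supp.mp hx
      exact hn t
    obtain ⟨t, ht⟩ := h1
    refine Matrix.det_eq_zero_of_column_eq_zero t fun i => ?_
    have : J' t ≠ J i := fun h => ht (mem_supp.mpr ⟨i, h.symm⟩)
    simp [coordMatrix, this]

theorem det_coordMatrix_comp (J J' : Fin k ↪o Fin m) (σ : Equiv.Perm (Fin k)) :
    ((coordMatrix A (J ∘ σ)).submatrix id J').det =
      ((Equiv.Perm.sign σ : ℤ) : A) * (Pi.single J 1 : (Fin k ↪o Fin m) → A) J' := by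
  rw [← det_coordMatrix, ← Matrix.det_permute σ]
  rfl

end Minors

/-! ### The tangent space at a coordinate point -/

section TangentGrassmannian

variable {K : Type*} [Field K] {k m : ℕ}

theorem minors_coordMatrix (J : Fin k ↪o Fin m) : minors (coordMatrix K J) = Pi.single J 1 :=
  funext fun J' => det_coordMatrix J J'

variable (K k m) in
/-- The affine cone, without its vertex, over the Grassmannian. -/
def minorCone : Set ((Fin k ↪o Fin m) → K) :=
  {v | v ≠ 0 ∧ ∃ M : Matrix (Fin k) (Fin m) K, minors M = v}

theorem smul_mem_minorCone [NeZero k] {c : K} (hc : c ≠ 0) {v : (Fin k ↪o Fin m) → K}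
    (hv : v ∈ minorCone K k m) : c • v ∈ minorCone K k m := by
  obtain ⟨h0, M, rfl⟩ := hv
  refine ⟨smul_ne_zero hc h0, M.updateRow 0 (c • M 0), ?_⟩
  funext J
  have : (M.updateRow 0 (c • M 0)).submatrix id J =
      (M.submatrix id J).updateRow 0 (c • (M.submatrix id J) 0) := by
    ext s t
    by_cases h : s = 0
    · subst h
      simp
    · simp [h]
  rw [minors, this, Matrix.det_updateRow_smul, Matrix.updateRow_eq_self]
  rfl

/-- Minors are linear in each row, so adding a multiple of `e_j` to one row of the coordinate matrix
of `I` traces the line from `e_I` towards `e_J`. The factor `sign σ` undoes the sign from sorting.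
-/
theorem single_add_mem_minorCone [NeZero k] {I J : Fin k ↪o Fin m} (h : Near I J) (t : K)
    (ht : (Pi.single I 1 + t • Pi.single J 1 : (Fin k ↪o Fin m) → K) ≠ 0) :
    (Pi.single I 1 + t • Pi.single J 1 : (Fin k ↪o Fin m) → K) ∈ minorCone K k m := by
  obtain ⟨i, j, σ, hσ⟩ := h.exists_update
  refine ⟨ht, (coordMatrix K I).updateRow i
    (coordMatrix K I i + (t * ((Equiv.Perm.sign σ : ℤ) : K)) • Pi.single j 1), ?_⟩
  funext J'
  have h1 : ((coordMatrix K I).updateRow i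
      (coordMatrix K I i + (t * ((Equiv.Perm.sign σ : ℤ) : K)) • Pi.single j 1)).submatrix id J' =
      ((coordMatrix K I).submatrix id J').updateRow i (((coordMatrix K I).submatrix id J') i +
        (t * ((Equiv.Perm.sign σ : ℤ) : K)) • ((Pi.single j 1 : Fin m → K) ∘ J')) := by
    ext s u
    by_cases h : s = i
    · subst h
      simp
    · simp [h]
  have h2 : ((coordMatrix K I).submatrix id J').updateRow i ((Pi.single j 1 : Fin m → K) ∘ J') =
      (coordMatrix K (J ∘ σ)).submatrix id J' := by
    rw [← hσ]
    ext s u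
    by_cases h : s = i
    · subst h
      simp [coordMatrix]
    · simp [h, coordMatrix]
  have h3 : ((Equiv.Perm.sign σ : ℤ) : K) * ((Equiv.Perm.sign σ : ℤ) : K) = 1 := by
    rw [← Int.cast_mul, ← Units.val_mul, Int.units_mul_self]
    simp
  rw [minors, h1, Matrix.det_updateRow_add, Matrix.det_updateRow_smul, h2, det_coordMatrix_comp,
    Matrix.updateRow_eq_self, det_coordMatrix]
  simp only [Pi.add_apply, Pi.smul_apply, smul_eq_mul]
  linear_combination (t * (Pi.single J 1 : (Fin k ↪o Fin m) → K) J') * h3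

/-- The polynomial `det (nearMatrix I x)_J - x_I ^ (k - 1) x_J`, which vanishes on the
Grassmannian. -/
def nearRelation (K : Type*) [Field K] (I J : Fin k ↪o Fin m) :
    MvPolynomial (Fin k ↪o Fin m) K :=
  ((nearMatrix I MvPolynomial.X).submatrix id J).det -
    MvPolynomial.X I ^ (k - 1) * MvPolynomial.X J

theorem aeval_nearRelation {A : Type*} [CommRing A] [Algebra K A] (I J : Fin k ↪o Fin m)
    (p : (Fin k ↪o Fin m) → A) :
    MvPolynomial.aeval p (nearRelation K I J) =
      ((nearMatrix I p).submatrix id J).det - p I ^ (k - 1) * p J := by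
  have h := map_nearMatrix (MvPolynomial.aeval (R := K) p).toRingHom I MvPolynomial.X
  have h1 : (fun J => (MvPolynomial.aeval (R := K) p).toRingHom (MvPolynomial.X J)) = p := by
    funext J
    simp
  rw [h1] at h
  rw [nearRelation, map_sub, map_mul, map_pow, MvPolynomial.aeval_X, MvPolynomial.aeval_X,
    AlgHom.map_det, ← h]
  rfl

theorem nearRelation_mem (I J : Fin k ↪o Fin m) :
    nearRelation K I J ∈ MvPolynomial.vanishingIdeal K (minorCone K k m) := by
  rw [MvPolynomial.mem_vanishingIdeal_iff]
  rintro _ ⟨-, M, rfl⟩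
  rw [aeval_nearRelation, sub_eq_zero]
  exact det_nearMatrix_minors I J M

theorem fst_nearMatrix_dualPoint (I : Fin k ↪o Fin m) (v : (Fin k ↪o Fin m) → K) (i : Fin k)
    {j : Fin m} (hj : j ∉ supp I) :
    (nearMatrix I (dualPoint (Pi.single I 1) v) i j).fst = 0 := by
  rw [nearMatrix, Matrix.of_apply]
  by_cases ha : Function.Injective (Function.update I i j)
  · obtain ⟨J, σ, h⟩ := exists_sort ha
    rw [h, altExt_comp]
    have hne : J ≠ I := by
      rintro rfl
      apply hj
      rw [← supp_eq_of_comp h]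
      exact Finset.mem_image.mpr ⟨i, Finset.mem_univ _, by simp⟩
    simp [dualPoint, hne]
  · simp [altExt_of_not_injective _ ha]

/-- Near directions are tangent because the cone contains lines along them; `nearRelation` kills
every other coordinate. -/
theorem tangentVec_minorCone_single [Infinite K] [NeZero k] (I : Fin k ↪o Fin m)
    (v : (Fin k ↪o Fin m) → K) :
    v ∈ tangentVec (minorCone K k m) (Pi.single I 1) ↔ ∀ J, ¬ Near I J → v J = 0 := by
  constructor
  · intro hv J hJ
    have h := mem_tangentVec_iff.mp hv _ (nearRelation_mem I J)
    rw [aeval_nearRelation] at h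
    rw [Near, not_le, Finset.one_lt_card] at hJ
    obtain ⟨x, hx, y, hy, hxy⟩ := hJ
    rw [Finset.mem_sdiff] at hx hy
    obtain ⟨s, rfl⟩ := mem_supp.mp hx.1
    obtain ⟨t, rfl⟩ := mem_supp.mp hy.1
    have hst : s ≠ t := fun h => hxy (by rw [h])
    -- Two columns of `J` lie outside `I`, so each term of the determinant contains two multiples of
    -- `ε`, and `ε² = 0`.
    have hdet : ((nearMatrix I (dualPoint (Pi.single I 1) v)).submatrix id J).det = 0 := by
      rw [Matrix.det_apply]
      refine Finset.sum_eq_zero fun σ _ => ?_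
      rw [← Finset.mul_prod_erase _ _ (Finset.mem_univ s),
        ← Finset.mul_prod_erase _ _ (Finset.mem_erase.mpr ⟨hst.symm, Finset.mem_univ t⟩),
        ← mul_assoc]
      have h0 : (nearMatrix I (dualPoint (Pi.single I 1) v)) (σ s) (J s) *
          (nearMatrix I (dualPoint (Pi.single I 1) v)) (σ t) (J t) = 0 := by
        have h1 := fst_nearMatrix_dualPoint I v (σ s) hx.2
        have h2 := fst_nearMatrix_dualPoint I v (σ t) hy.2
        ext <;> simp [h1, h2]
      simp only [Matrix.submatrix_apply, id]
      rw [h0, zero_mul, smul_zero]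
    have hne : J ≠ I := by
      rintro rfl
      exact hx.2 hx.1
    rw [hdet] at h
    simpa [dualPoint, hne] using h
  · intro hv
    classical
    have h1 : v = ∑ J, v J • (Pi.single J 1 : (Fin k ↪o Fin m) → K) := by
      funext J
      simp [Finset.sum_apply, Pi.single_apply]
    rw [h1]
    refine Submodule.sum_mem _ fun J _ => ?_
    by_cases hJ : Near I J
    · refine Submodule.smul_mem _ _ (mem_tangentVec_of_line ?_)
      -- For `J = I` the parameter `t = -1` gives the vertex, which the cone omits.
      refine (Set.Finite.infinite_compl (Set.finite_singleton (-1 : K))).mono ?_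
      intro t ht
      refine single_add_mem_minorCone hJ t fun h0 => ?_
      have h2 := congrFun h0 I
      by_cases hIJ : J = I
      · subst hIJ
        simp at h2
        exact ht (by rw [Set.mem_singleton_iff]; linear_combination h2)
      · simp [Pi.single_eq_of_ne (Ne.symm hIJ)] at h2
    · rw [hv J hJ, zero_smul]
      exact Submodule.zero_mem _

end TangentGrassmannian

/-! ### The dimension of the Grassmannian -/

section Dimension

variable {K : Type*} [Field K] {k m : ℕ}

theorem linearIndependent_row_of_minors_ne_zero {M : Matrix (Fin k) (Fin m) K}
    (h : minors M ≠ 0) : LinearIndependent K M.row := by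
  obtain ⟨J, hJ⟩ := Function.ne_iff.mp h
  have h1 : LinearIndependent K (M.submatrix id J).row :=
    Matrix.linearIndependent_rows_of_det_ne_zero hJ
  exact LinearIndependent.of_comp (LinearMap.funLeft K K J) h1

/-- The homomorphism sending the Plücker coordinates to the maximal minors of a generic
matrix. -/
def genericMinors (K : Type*) [Field K] (k m : ℕ) :
    MvPolynomial (Fin k ↪o Fin m) K →ₐ[K] MvPolynomial (Fin k × Fin m) K :=
  MvPolynomial.aeval fun J => ((Matrix.mvPolynomialX (Fin k) (Fin m) K).submatrix id J).det

theorem eval_genericMinors (M : Matrix (Fin k) (Fin m) K)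
    (F : MvPolynomial (Fin k ↪o Fin m) K) :
    MvPolynomial.eval (fun p => M p.1 p.2) (genericMinors K k m F) =
      MvPolynomial.aeval (minors M) F := by
  have h : (MvPolynomial.aeval (R := K) fun p : Fin k × Fin m => M p.1 p.2).comp
      (genericMinors K k m) = MvPolynomial.aeval (minors M) := by
    apply MvPolynomial.algHom_ext
    intro J
    rw [AlgHom.comp_apply, genericMinors, MvPolynomial.aeval_X, MvPolynomial.aeval_X,
      AlgHom.map_det, minors]
    congr 1
    ext i j
    simp [Matrix.mvPolynomialX]
  exact DFunLike.congr_fun h F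

theorem mem_vanishingIdeal_minorCone_iff [Infinite K] (I : Fin k ↪o Fin m)
    (F : MvPolynomial (Fin k ↪o Fin m) K) :
    F ∈ MvPolynomial.vanishingIdeal K (minorCone K k m) ↔ genericMinors K k m F = 0 := by
  rw [MvPolynomial.mem_vanishingIdeal_iff]
  constructor
  · intro h
    -- The factor `X I` covers matrices all of whose minors vanish, since the cone omits the vertex.
    -- It cancels because the generic minor at `I` is nonzero.
    have h1 : genericMinors K k m (MvPolynomial.X I * F) = 0 := by
      apply MvPolynomial.funext
      intro x
      have h2 := eval_genericMinors (Matrix.of fun i j => x (i, j)) (MvPolynomial.X I * F)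
      refine h2.trans ?_
      rw [map_mul, MvPolynomial.aeval_X, map_zero]
      by_cases h0 : minors (Matrix.of fun i j => x (i, j)) = 0
      · rw [h0, Pi.zero_apply, zero_mul]
      · rw [h _ ⟨h0, _, rfl⟩, mul_zero]
    rw [map_mul] at h1
    refine (mul_eq_zero.mp h1).resolve_left fun h2 => ?_
    have h3 := eval_genericMinors (coordMatrix K I) (MvPolynomial.X I)
    rw [h2, MvPolynomial.aeval_X, minors_coordMatrix] at h3
    simp at h3
  · rintro h _ ⟨-, M, rfl⟩
    rw [← eval_genericMinors, h, map_zero]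

theorem isPrime_vanishingIdeal_minorCone [Infinite K] (I : Fin k ↪o Fin m) :
    (MvPolynomial.vanishingIdeal K (minorCone K k m)).IsPrime := by
  have h : MvPolynomial.vanishingIdeal K (minorCone K k m) =
      RingHom.ker (genericMinors K k m).toRingHom := by
    ext F
    exact mem_vanishingIdeal_minorCone_iff I F
  rw [h]
  exact RingHom.ker_isPrime _

/-- There is a point of the Grassmannian with arbitrarily given coordinates at the sequences near
`I`, as long as the coordinate at `I` is not zero. -/
theorem exists_mem_minorCone [NeZero k] (I : Fin k ↪o Fin m) (q : (Fin k ↪o Fin m) → K)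
    (hq : q I ≠ 0) : ∃ v ∈ minorCone K k m, ∀ J, Near I J → v J = q J := by
  -- The affine chart at `I`: with identity block in the columns `I`, the entries of `N` are, up to
  -- sign, the near minors.
  let N : Matrix (Fin k) (Fin m) K := (q I)⁻¹ • nearMatrix I q
  have hN : N.submatrix id I = 1 := by
    have : N.submatrix id I = (q I)⁻¹ • (nearMatrix I q).submatrix id I := rfl
    rw [this, nearMatrix_submatrix_self, smul_smul, inv_mul_cancel₀ hq, one_smul]
  have hI : minors N I = 1 := by
    rw [minors, hN, Matrix.det_one]
  have h0 : minors N ≠ 0 := fun h => by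
    rw [h] at hI
    exact zero_ne_one hI
  refine ⟨q I • minors N, smul_mem_minorCone hq ⟨h0, N, rfl⟩, fun J hJ => ?_⟩
  obtain ⟨i, j, σ, h⟩ := hJ.exists_update
  have h1 := altExt_minors N (Function.update I i j)
  rw [det_submatrix_update_of_eq_one hN] at h1
  have h2 : N i j = (q I)⁻¹ * altExt q (Function.update I i j) := rfl
  rw [h2, h, altExt_comp, altExt_comp] at h1
  have h3 : ((Equiv.Perm.sign σ : ℤ) : K) ≠ 0 := by
    rcases Int.units_eq_one_or (Equiv.Perm.sign σ) with h | h <;> simp [h]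
  have h4 : (N.submatrix id J).det = (q I)⁻¹ * q J := by
    apply mul_left_cancel₀ h3
    rw [h1]
    ring
  rw [Pi.smul_apply, minors, h4, smul_eq_mul, mul_inv_cancel_left₀ hq]

/-- Independence holds because the near coordinates can be prescribed freely on the cone once `x_I ≠
0`. The other coordinates are algebraic over them by `nearRelation`, as `x_I` is nonzero in a
domain. -/
theorem isTranscendenceBasis_near [Infinite K] [NeZero k] (I : Fin k ↪o Fin m) :
    IsTranscendenceBasis K (fun J : {J // Near I J} =>
      Ideal.Quotient.mkₐ K (MvPolynomial.vanishingIdeal K (minorCone K k m))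
        (MvPolynomial.X J.1)) := by
  have hprime := isPrime_vanishingIdeal_minorCone (K := K) I
  have hII : Near I I := by simp [Near]
  rw [isTranscendenceBasis_iff_algebraicIndependent_isAlgebraic]
  set π := Ideal.Quotient.mkₐ K (MvPolynomial.vanishingIdeal K (minorCone K k m)) with hπ
  have hπ0 : ∀ F, π F = 0 ↔ F ∈ MvPolynomial.vanishingIdeal K (minorCone K k m) := fun F =>
    Ideal.Quotient.eq_zero_iff_mem
  constructor
  · rw [algebraicIndependent_iff]
    intro p hp
    have h1 : MvPolynomial.rename Subtype.val p ∈
        MvPolynomial.vanishingIdeal K (minorCone K k m) := by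
      rw [← hπ0, ← hp]
      have : π.comp (MvPolynomial.rename Subtype.val) =
          MvPolynomial.aeval fun J : {J // Near I J} => π (MvPolynomial.X J.1) := by
        apply MvPolynomial.algHom_ext
        intro J
        simp
      exact DFunLike.congr_fun this p
    -- Multiplying by `X_I` disposes of the values with `q I = 0`, where no point of the cone is
    -- supplied.
    have h2 : MvPolynomial.X ⟨I, hII⟩ * p = 0 := by
      apply MvPolynomial.funext
      intro q
      rw [map_mul, MvPolynomial.eval_X, map_zero]
      by_cases hq : q ⟨I, hII⟩ = 0
      · rw [hq, zero_mul]
      · classical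
        obtain ⟨v, hv, hvq⟩ := exists_mem_minorCone I
          (fun J => if h : Near I J then q ⟨J, h⟩ else 0) (by simpa [hII] using hq)
        have h3 := MvPolynomial.mem_vanishingIdeal_iff.mp h1 v hv
        rw [MvPolynomial.aeval_rename] at h3
        have h4 : v ∘ Subtype.val = q := by
          funext J
          simp [hvq J.1 J.2, J.2]
        rw [h4] at h3
        rw [← MvPolynomial.coe_aeval_eq_eval]
        exact mul_eq_zero_of_right _ h3
    exact (mul_eq_zero.mp h2).resolve_left (MvPolynomial.X_ne_zero _)
  · set S := Algebra.adjoin K (Set.range fun J : {J // Near I J} => π (MvPolynomial.X J.1))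
    have hmem : ∀ J, Near I J → π (MvPolynomial.X J) ∈ S := fun J hJ =>
      Algebra.subset_adjoin ⟨⟨J, hJ⟩, rfl⟩
    have hX : ∀ J, IsAlgebraic S (π (MvPolynomial.X J)) := by
      intro J
      have hne : π (MvPolynomial.X I) ≠ 0 := by
        intro h
        rw [hπ0, MvPolynomial.mem_vanishingIdeal_iff] at h
        have h1 := h (Pi.single I 1) ⟨by simp, _, minors_coordMatrix I⟩
        simp at h1
      have hrel : ((nearMatrix I fun J => π (MvPolynomial.X J)).submatrix id J).det =
          π (MvPolynomial.X I) ^ (k - 1) * π (MvPolynomial.X J) := by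
        have h1 := (hπ0 _).mpr (nearRelation_mem (K := K) I J)
        have h2 : π = MvPolynomial.aeval fun J => π (MvPolynomial.X J) :=
          MvPolynomial.algHom_ext fun J => by simp
        rw [h2, aeval_nearRelation, sub_eq_zero] at h1
        exact h1
      have hN : ∀ i j, nearMatrix I (fun J => π (MvPolynomial.X J)) i j ∈ S := by
        intro i j
        rw [nearMatrix, Matrix.of_apply]
        by_cases ha : Function.Injective (Function.update I i j)
        · obtain ⟨J', σ, h⟩ := exists_sort ha
          rw [h, altExt_comp]
          exact S.mul_mem (intCast_mem S _) (hmem J' (near_of_update h))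
        · rw [altExt_of_not_injective _ ha]
          exact S.zero_mem
      have hdet : π (MvPolynomial.X I) ^ (k - 1) * π (MvPolynomial.X J) ∈ S := by
        rw [← hrel, Matrix.det_apply]
        refine S.sum_mem fun σ _ => ?_
        rw [Units.smul_def]
        exact zsmul_mem (S.prod_mem fun i _ => hN _ _) _
      refine IsAlgebraic.of_mul (y := π (MvPolynomial.X I) ^ (k - 1))
        (mem_nonZeroDivisors_of_ne_zero (pow_ne_zero _ hne)) ?_ ?_
      · exact isAlgebraic_algebraMap (⟨_, S.pow_mem (hmem I hII) _⟩ : S)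
      · exact isAlgebraic_algebraMap (⟨_, hdet⟩ : S)
    constructor
    intro x
    obtain ⟨F, rfl⟩ := Ideal.Quotient.mkₐ_surjective K _ x
    rw [← hπ]
    induction F using MvPolynomial.induction_on with
    | C a => exact isAlgebraic_algebraMap (algebraMap K S a)
    | add p q hp hq =>
      rw [map_add]
      exact hp.add hq
    | mul_X p J hp =>
      rw [map_mul]
      exact hp.mul (hX J)

theorem minors_smul_of_span_le {M M' : Matrix (Fin k) (Fin m) K}
    (h : ∀ i, M' i ∈ Submodule.span K (Set.range M)) :
    ∃ c : K, minors M' = c • minors M := by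
  have h1 : ∀ i, ∃ c : Fin k → K, ∑ j, c j • M j = M' i := fun i =>
    (Submodule.mem_span_range_iff_exists_fun K).mp (h i)
  choose P hP using h1
  have h2 : M' = Matrix.of P * M := by
    ext i j
    rw [← hP i]
    simp [Matrix.mul_apply, Finset.sum_apply]
  refine ⟨(Matrix.of P).det, ?_⟩
  funext J
  rw [Pi.smul_apply, minors, minors, h2, Matrix.submatrix_mul _ _ id id J Function.bijective_id,
    Matrix.det_mul]
  rfl

variable {r n : ℕ}

theorem span_range_basisMatrix (U : Gr K r n) :
    Submodule.span K (Set.range (basisMatrix U)) = U.1 := by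
  have h : Set.range (basisMatrix U) =
      U.1.subtype '' Set.range (Module.finBasisOfFinrankEq K U.1 U.2) := by
    rw [← Set.range_comp]
    rfl
  rw [h, Submodule.span_image, Module.Basis.span_eq, Submodule.map_top, Submodule.range_subtype]

theorem exists_smul_minors_basisMatrix (U : Gr K r n) {M : Matrix (Fin (r + 1)) (Fin (n + 1)) K}
    (hM : Submodule.span K (Set.range M) = U.1) :
    ∃ c : K, c ≠ 0 ∧ minors (basisMatrix U) = c • minors M := by
  obtain ⟨c, hc⟩ := minors_smul_of_span_le (M := M) (M' := basisMatrix U) fun i => by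
    rw [hM, ← span_range_basisMatrix U]
    exact Submodule.subset_span ⟨i, rfl⟩
  refine ⟨c, ?_, hc⟩
  rintro rfl
  rw [zero_smul] at hc
  exact minors_ne_zero _ (linearIndependent_basisMatrix U) hc

theorem cone_grassmannian : cone (grassmannian K r n) = minorCone K (r + 1) (n + 1) := by
  ext v
  constructor
  · rintro ⟨hv, U, hU⟩
    rw [plucker, Projectivization.mk_eq_mk_iff'] at hU
    obtain ⟨a, ha⟩ := hU
    have ha0 : a ≠ 0 := by
      rintro rfl
      rw [zero_smul] at ha
      exact minors_ne_zero _ (linearIndependent_basisMatrix U) ha.symm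
    have : v = a⁻¹ • minors (basisMatrix U) := by
      rw [← ha, smul_smul, inv_mul_cancel₀ ha0, one_smul]
    rw [this]
    exact smul_mem_minorCone (inv_ne_zero ha0)
      ⟨minors_ne_zero _ (linearIndependent_basisMatrix U), _, rfl⟩
  · rintro ⟨hv, M, rfl⟩
    have hM := linearIndependent_row_of_minors_ne_zero hv
    let U : Gr K r n := ⟨Submodule.span K (Set.range M), by
      rw [finrank_span_eq_card (b := M) hM, Fintype.card_fin]⟩
    obtain ⟨c, hc, hcM⟩ := exists_smul_minors_basisMatrix U (M := M) rfl
    exact ⟨hv, U, (Projectivization.mk_eq_mk_iff' _ _ _ _ _).mpr ⟨c, hcM.symm⟩⟩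

open scoped Classical in
-- The count is left unevaluated: it is only compared with counts of near sequences. Since `I` is
-- arbitrary, `I` and `I'` have equally many.
theorem dim_grassmannian [Infinite K] (I : Fin (r + 1) ↪o Fin (n + 1)) :
    dim (grassmannian K r n) = (Finset.univ.filter (Near I)).card - 1 := by
  have h : MvPolynomial.vanishingIdeal K (minorCone K (r + 1) (n + 1)) =
      coneIdeal (grassmannian K r n) := by
    rw [coneIdeal, cone_grassmannian]
  have hprime := isPrime_vanishingIdeal_minorCone (K := K) I
  have hb := isTranscendenceBasis_near (K := K) I
  rw [h] at hb hprime
  have h1 := congrArg Cardinal.toNat hb.lift_cardinalMk_eq_trdeg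
  rw [Cardinal.toNat_lift, Cardinal.toNat_lift] at h1
  rw [dim, ← h1, Cardinal.mk_toNat_eq_card, Fintype.card_subtype]

end Dimension

/-! ### Linear automorphisms acting on Plücker coordinates -/

section LinearAction

variable {K : Type*} [Field K] {k m : ℕ}

variable (K k m) in
/-- The coordinates on the exterior power given by increasing sequences. -/
def pluckerEquiv : (⋀[K]^k (Fin m → K)) ≃ₗ[K] ((Fin k ↪o Fin m) → K) :=
  (((Pi.basisFun K (Fin m)).exteriorPower k).reindex
    Set.powersetCard.ofFinEmbEquiv.symm).equivFun

theorem pluckerEquiv_ιMulti (M : Fin k → Fin m → K) :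
    pluckerEquiv K k m (exteriorPower.ιMulti K k M) = minors (Matrix.of M) := by
  funext J
  simp only [pluckerEquiv, Module.Basis.equivFun_apply, Module.Basis.repr_reindex_apply,
    Equiv.symm_symm]
  rw [exteriorPower.basis_repr_apply, exteriorPower.ιMultiDual_apply_ιMulti, minors]
  simp only [Equiv.symm_apply_apply, Module.Basis.coord_apply, Pi.basisFun_repr]
  rfl

/-- The isomorphism between exterior powers induced by an isomorphism. -/
def exteriorPowerEquiv (f : (Fin m → K) ≃ₗ[K] (Fin m → K)) :
    (⋀[K]^k (Fin m → K)) ≃ₗ[K] (⋀[K]^k (Fin m → K)) :=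
  LinearEquiv.ofLinearMap (exteriorPower.map k f) (exteriorPower.map k f.symm)
    (by rw [← exteriorPower.map_comp]; simp) (by rw [← exteriorPower.map_comp]; simp)

/-- The action of a linear automorphism on the Plücker coordinates. -/
def pluckerAction (k : ℕ) (f : (Fin m → K) ≃ₗ[K] (Fin m → K)) :
    ((Fin k ↪o Fin m) → K) ≃ₗ[K] ((Fin k ↪o Fin m) → K) :=
  (pluckerEquiv K k m).symm ≪≫ₗ exteriorPowerEquiv f ≪≫ₗ pluckerEquiv K k m

/-- Minors are the coordinates of the wedge of the rows, and the exterior power is functorial. -/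
theorem pluckerAction_minors (f : (Fin m → K) ≃ₗ[K] (Fin m → K))
    (M : Matrix (Fin k) (Fin m) K) :
    pluckerAction k f (minors M) = minors (Matrix.of fun i => f (M i)) := by
  have h : minors M = pluckerEquiv K k m (exteriorPower.ιMulti K k M.row) :=
    (pluckerEquiv_ιMulti M.row).symm
  rw [h, ← pluckerEquiv_ιMulti]
  simp only [pluckerAction, LinearEquiv.trans_apply, LinearEquiv.symm_apply_apply]
  congr 1
  exact exteriorPower.map_apply_ιMulti _ _

theorem pluckerAction_mem_minorCone (f : (Fin m → K) ≃ₗ[K] (Fin m → K))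
    (x : (Fin k ↪o Fin m) → K) (hx : x ∈ minorCone K k m) :
    pluckerAction k f x ∈ minorCone K k m := by
  obtain ⟨h0, M, rfl⟩ := hx
  exact ⟨by simpa using h0, _, (pluckerAction_minors f M).symm⟩

end LinearAction

/-! ### A basis adapted to two subspaces -/

section AdaptedBasis

variable {K V : Type*} [Field K] [AddCommGroup V] [Module K V] [FiniteDimensional K V]

theorem ncard_eq_finrank_span {s : Set V} (hs : LinearIndepOn K id s) :
    s.ncard = Module.finrank K (Submodule.span K s) := by
  have hfin : s.Finite := hs.finite
  have := hfin.fintype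
  rw [finrank_span_set_eq_card hs, Set.ncard_eq_toFinset_card']

/-- A basis of `U ⊓ U'` is extended to bases of `U` and of `U'`. Their union spans `U ⊔ U'` and has
at most `dim (U ⊔ U')` elements, hence is independent; counting again gives the size of the
intersection. -/
theorem exists_adapted_linearIndepOn (U U' : Submodule K V) :
    ∃ s s' : Set V, LinearIndepOn K id (s ∪ s') ∧ Submodule.span K s = U ∧
      Submodule.span K s' = U' ∧ (s ∩ s').ncard = Module.finrank K ↥(U ⊓ U') := by
  obtain ⟨s₀, hs₀, hspan₀, hli₀⟩ := exists_linearIndependent K ((U ⊓ U' : Submodule K V) : Set V)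
  have hli₀' : LinearIndepOn K id s₀ := hli₀
  rw [Submodule.span_eq] at hspan₀
  have key : ∀ W : Submodule K V, s₀ ⊆ W → ∃ s : Set V, s₀ ⊆ s ∧ Submodule.span K s = W ∧
      LinearIndepOn K id s := by
    intro W hW
    obtain ⟨s, hsW, hs, hWs, hli⟩ := exists_linearIndepOn_id_extension hli₀' hW
    exact ⟨s, hs, le_antisymm (Submodule.span_le.mpr hsW) hWs, hli⟩
  obtain ⟨s, hs, hspan, hli⟩ := key U (hs₀.trans fun x hx => hx.1)
  obtain ⟨s', hs', hspan', hli'⟩ := key U' (hs₀.trans fun x hx => hx.2)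
  have hfin : s.Finite := hli.finite
  have hfin' : s'.Finite := hli'.finite
  have h0 := ncard_eq_finrank_span hli₀'
  have h1 := ncard_eq_finrank_span hli
  have h2 := ncard_eq_finrank_span hli'
  rw [hspan₀] at h0
  rw [hspan] at h1
  rw [hspan'] at h2
  have h3 : Submodule.span K (s ∪ s') = U ⊔ U' := by
    rw [Submodule.span_union, hspan, hspan']
  have h4 := Set.ncard_union_add_ncard_inter s s' hfin hfin'
  have h5 : s₀.ncard ≤ (s ∩ s').ncard :=
    Set.ncard_le_ncard (Set.subset_inter hs hs') (hfin.inter_of_left _)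
  have h6 := Submodule.finrank_sup_add_finrank_inf_eq U U'
  have hli'' : LinearIndepOn K id (s ∪ s') := by
    have := (hfin.union hfin').fintype
    refine linearIndependent_iff_card_le_finrank_span.mpr ?_
    have h7 : Set.range (fun x : ↥(s ∪ s') => id (x : V)) = s ∪ s' := Subtype.range_coe
    rw [h7, Set.finrank, h3, ← Nat.card_eq_fintype_card, Nat.card_coe_set_eq]
    omega
  refine ⟨s, s', hli'', hspan, hspan', ?_⟩
  have h8 := ncard_eq_finrank_span hli''
  rw [h3] at h8
  omega

variable {k m : ℕ}

/-- Any two subspaces are coordinate subspaces in a suitable basis. -/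
theorem exists_linearEquiv_coordinate (U U' : Submodule K (Fin m → K))
    (hU : Module.finrank K U = k) (hU' : Module.finrank K U' = k) :
    ∃ (f : (Fin m → K) ≃ₗ[K] (Fin m → K)) (I I' : Fin k ↪o Fin m),
      Submodule.span K (Set.range fun i => f (coordMatrix K I i)) = U ∧
      Submodule.span K (Set.range fun i => f (coordMatrix K I' i)) = U' ∧
      (supp I ∩ supp I').card = Module.finrank K ↥(U ⊓ U') := by
  classical
  obtain ⟨s, s', hli, hspan, hspan', hcard⟩ := exists_adapted_linearIndepOn U U'
  let b₀ := Module.Basis.extend hli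
  have hsub : s ∪ s' ⊆ Set.range b₀ := by
    rw [Module.Basis.range_extend]
    exact hli.subset_extend _
  have hfin : Fintype ↥(hli.extend (Set.subset_univ (s ∪ s'))) :=
    FiniteDimensional.fintypeBasisIndex b₀
  let e := Fintype.equivFinOfCardEq
    ((Module.finrank_eq_card_basis b₀).symm.trans (Module.finrank_fin_fun K))
  let b : Module.Basis (Fin m) K (Fin m → K) := b₀.reindex e
  have hrange : Set.range b = Set.range b₀ := Module.Basis.range_reindex b₀ e
  let pre : Set (Fin m → K) → Finset (Fin m) := fun t => Finset.univ.filter fun i => b i ∈ t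
  have hpre : ∀ t ⊆ s ∪ s', b '' (pre t) = t := by
    intro t ht
    have : (pre t : Set (Fin m)) = b ⁻¹' t := by
      ext i
      simp [pre]
    rw [this, Set.image_preimage_eq_iff, hrange]
    exact ht.trans hsub
  have hprecard : ∀ t ⊆ s ∪ s', (pre t).card = t.ncard := by
    intro t ht
    conv_rhs => rw [← hpre t ht]
    rw [Set.ncard_image_of_injective _ b.injective, Set.ncard_coe_finset]
  have hs := Set.subset_union_left (s := s) (t := s')
  have hs' := Set.subset_union_right (s := s) (t := s')
  obtain ⟨I, hI⟩ := exists_supp_eq (s := pre s) (k := k) (by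
    rw [hprecard s hs, ncard_eq_finrank_span (hli.mono hs), hspan, hU])
  obtain ⟨I', hI'⟩ := exists_supp_eq (s := pre s') (k := k) (by
    rw [hprecard s' hs', ncard_eq_finrank_span (hli.mono hs'), hspan', hU'])
  let f := (Pi.basisFun K (Fin m)).equiv b (Equiv.refl _)
  have hf : ∀ J : Fin k ↪o Fin m, (Set.range fun i => f (coordMatrix K J i)) = b '' supp J := by
    intro J
    rw [coe_supp, ← Set.range_comp]
    congr 1
    funext i
    have : coordMatrix K J i = Pi.basisFun K (Fin m) (J i) := by
      rw [Pi.basisFun_apply]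
      rfl
    rw [this, Module.Basis.equiv_apply]
    rfl
  refine ⟨f, I, I', ?_, ?_, ?_⟩
  · rw [hf, hI, hpre s hs, hspan]
  · rw [hf, hI', hpre s' hs', hspan']
  · rw [hI, hI', ← hcard, ← hprecard (s ∩ s') (Set.inter_subset_left.trans hs)]
    congr 1
    ext i
    simp [pre]

end AdaptedBasis

/-! ### Sequences near two given ones -/

section Combinatorics

variable {k m : ℕ} {I I' J : Fin k ↪o Fin m}

theorem card_supp_sdiff_add (I J : Fin k ↪o Fin m) :
    (supp J \ supp I).card + (supp J ∩ supp I).card = k := by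
  rw [Finset.card_sdiff_add_card_inter, card_supp]

/-- `J` shares at least `k - 1` of its `k` entries with each of `I`, `I'`, hence at least `k - 2`
with both. -/
theorem Near.le_card_inter (h : Near I J) (h' : Near I' J) :
    k ≤ (supp I ∩ supp I').card + 2 := by
  have h1 := card_supp_sdiff_add I J
  have h2 := card_supp_sdiff_add I' J
  have h3 := Finset.card_union_add_card_inter (supp J ∩ supp I) (supp J ∩ supp I')
  have h4 : ((supp J ∩ supp I) ∪ (supp J ∩ supp I')).card ≤ k :=
    (Finset.card_le_card
      (Finset.union_subset Finset.inter_subset_left Finset.inter_subset_left)).trans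
      (card_supp J).le
  have h5 : ((supp J ∩ supp I) ∩ (supp J ∩ supp I')).card ≤ (supp I ∩ supp I').card :=
    Finset.card_le_card (Finset.inter_subset_inter Finset.inter_subset_right
      Finset.inter_subset_right)
  unfold Near at h h'
  omega

theorem exists_near_near (h : k ≤ (supp I ∩ supp I').card + 2) : ∃ J, Near I J ∧ Near I' J := by
  have h1 := card_supp_sdiff_add I I'
  have h2 := card_supp_sdiff_add I' I
  rw [Finset.inter_comm] at h1
  by_cases hle : (supp I' \ supp I).card ≤ 1
  · exact ⟨I', hle, by simp [Near]⟩
  · have h3 : (supp I \ supp I').card = 2 := by omega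
    obtain ⟨y, hy⟩ := Finset.card_pos.mp (show 0 < (supp I' \ supp I).card by omega)
    obtain ⟨x, hx⟩ := Finset.card_pos.mp (show 0 < (supp I \ supp I').card by omega)
    have hy' := Finset.mem_sdiff.mp hy
    have hx' := Finset.mem_sdiff.mp hx
    -- Halfway from `I` to `I'`: one of the two exchanges is made.
    obtain ⟨J, hJ⟩ := exists_supp_eq (s := insert y ((supp I).erase x)) (k := k) (by
      rw [Finset.card_insert_of_notMem fun h => hy'.2 (Finset.mem_of_mem_erase h),
        Finset.card_erase_of_mem hx'.1, card_supp]
      have := Finset.card_pos.mpr ⟨x, hx'.1⟩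
      rw [card_supp] at this
      omega)
    refine ⟨J, ?_, ?_⟩
    · refine (Finset.card_le_card (t := {y}) ?_).trans (by simp)
      rw [hJ]
      intro z hz
      simp only [Finset.mem_sdiff, Finset.mem_insert, Finset.mem_erase, Finset.mem_singleton] at hz ⊢
      tauto
    · have h4 : ((supp I \ supp I').erase x).card = 1 := by
        rw [Finset.card_erase_of_mem hx, h3]
      refine (Finset.card_le_card ?_).trans h4.le
      rw [hJ]
      intro z hz
      simp only [Finset.mem_sdiff, Finset.mem_insert, Finset.mem_erase] at hz ⊢
      obtain ⟨rfl | h, h'⟩ := hz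
      · exact absurd hy'.1 h'
      · exact ⟨h.1, h.2, h'⟩

/-- `J` is chosen to avoid two entries of `I` and two of `I'`. This needs `|A ∪ A'| ≤ m - k`, so the
pairs `A`, `A'` share as much of `I ∩ I'` as possible: at most 4, 3 or 2 elements for `k = 2`, `k =
3`, `k ≥ 4`. The first two cases use `m ≥ 6`, the last `k + 2 ≤ m`. -/
theorem exists_not_near (hk : 2 ≤ k) (hkm : k + 2 ≤ m) (hm : 6 ≤ m)
    (h : k ≤ (supp I ∩ supp I').card + 2) : ∃ J, ¬ Near I J ∧ ¬ Near I' J := by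
  obtain ⟨B, hB, hBcard⟩ := Finset.exists_subset_card_eq
    (min_le_right 2 (supp I ∩ supp I').card)
  have hext : ∀ L : Fin k ↪o Fin m, B ⊆ supp L → ∃ A, B ⊆ A ∧ A ⊆ supp L ∧ A.card = 2 := by
    intro L hL
    exact Finset.exists_subsuperset_card_eq hL (by omega) (by rwa [card_supp])
  obtain ⟨A, hBA, hAI, hA⟩ := hext I (hB.trans Finset.inter_subset_left)
  obtain ⟨A', hBA', hAI', hA'⟩ := hext I' (hB.trans Finset.inter_subset_right)
  have h1 := Finset.card_union_add_card_inter A A'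
  have h2 := Finset.card_le_card (Finset.subset_inter hBA hBA')
  obtain ⟨C, hTC, -, hC⟩ := Finset.exists_subsuperset_card_eq (n := m - k)
    (Finset.subset_univ (A ∪ A')) (by omega) (by simp)
  obtain ⟨J, hJ⟩ := exists_supp_eq (s := Cᶜ) (k := k) (by
    rw [Finset.card_compl, hC, Fintype.card_fin]
    omega)
  have key : ∀ (L : Fin k ↪o Fin m) (T : Finset (Fin m)), T ⊆ supp L → T ⊆ C → T.card = 2 →
      ¬ Near L J := by
    intro L T hTL hTC hT hn
    have h3 := card_supp_sdiff_add L J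
    have h4 : (supp J ∩ supp L).card ≤ (supp L \ T).card := by
      refine Finset.card_le_card fun z hz => ?_
      rw [Finset.mem_inter, hJ, Finset.mem_compl] at hz
      exact Finset.mem_sdiff.mpr ⟨hz.2, fun hzT => hz.1 (hTC hzT)⟩
    rw [Finset.card_sdiff_of_subset hTL, card_supp, hT] at h4
    unfold Near at hn
    omega
  exact ⟨J, key I A hAI (Finset.subset_union_left.trans hTC) hA,
    key I' A' hAI' (Finset.subset_union_right.trans hTC) hA'⟩

end Combinatorics

/-! ### The Terracini condition for pairs of subspaces -/

section Main

variable {K : Type*} [Field K] {r n : ℕ}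

theorem exists_rep_point (U : Gr K r n) (f : (Fin (n + 1) → K) ≃ₗ[K] (Fin (n + 1) → K))
    (I : Fin (r + 1) ↪o Fin (n + 1))
    (h : Submodule.span K (Set.range fun i => f (coordMatrix K I i)) = U.1) :
    ∃ c : K, c ≠ 0 ∧ (U.point : ℙ K ((Fin (r + 1) ↪o Fin (n + 1)) → K)).rep =
      c • pluckerAction (r + 1) f (Pi.single I 1) := by
  obtain ⟨c, hc, hcM⟩ := exists_smul_minors_basisMatrix U
    (M := Matrix.of fun i => f (coordMatrix K I i)) h
  obtain ⟨a, ha⟩ := Projectivization.exists_smul_eq_mk_rep K (minors (basisMatrix U))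
    (minors_ne_zero _ (linearIndependent_basisMatrix U))
  refine ⟨a * c, mul_ne_zero a.ne_zero hc, ?_⟩
  rw [← minors_coordMatrix, pluckerAction_minors, mul_smul, ← hcM]
  exact ha.symm

theorem tangentSpace_point (U : Gr K r n) (f : (Fin (n + 1) → K) ≃ₗ[K] (Fin (n + 1) → K))
    (I : Fin (r + 1) ↪o Fin (n + 1))
    (h : Submodule.span K (Set.range fun i => f (coordMatrix K I i)) = U.1) :
    tangentSpace (grassmannian K r n) U.point =
      (tangentVec (minorCone K (r + 1) (n + 1)) (Pi.single I 1)).map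
        (pluckerAction (r + 1) f : _ →ₗ[K] _) := by
  obtain ⟨c, hc, hrep⟩ := exists_rep_point U f I h
  rw [tangentSpace_eq_tangentVec, cone_grassmannian, hrep,
    tangentVec_smul (fun c hc x hx => smul_mem_minorCone hc hx) hc,
    tangentVec_map _ (pluckerAction_mem_minorCone f) (pluckerAction_mem_minorCone f.symm)]

open scoped Classical in
theorem tangentVec_minorCone_eq_span [Infinite K] {k m : ℕ} [NeZero k] (I : Fin k ↪o Fin m) :
    tangentVec (minorCone K k m) (Pi.single I 1) =
      Submodule.span K (Pi.basisFun K (Fin k ↪o Fin m) '' (Finset.univ.filter (Near I))) := by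
  ext v
  rw [tangentVec_minorCone_single, Module.Basis.mem_span_image]
  constructor
  · intro h J hJ
    by_contra hn
    simp only [Finset.coe_filter, Finset.mem_univ, true_and, Set.mem_ofPred_eq] at hn
    simp [h J hn] at hJ
  · intro h J hJ
    by_contra hn
    have : J ∈ ((Pi.basisFun K (Fin k ↪o Fin m)).repr v).support := by simpa using hn
    have := h this
    simp only [Finset.coe_filter, Finset.mem_univ, true_and, Set.mem_ofPred_eq] at this
    exact hJ this

open scoped Classical in
-- A single `f` serves both points, so the join is the image of one coordinate subspace.
theorem finrank_iSup_tangentSpace [Infinite K] (U U' : Gr K r n)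
    (f : (Fin (n + 1) → K) ≃ₗ[K] (Fin (n + 1) → K)) (I I' : Fin (r + 1) ↪o Fin (n + 1))
    (h : Submodule.span K (Set.range fun i => f (coordMatrix K I i)) = U.1)
    (h' : Submodule.span K (Set.range fun i => f (coordMatrix K I' i)) = U'.1) :
    Module.finrank K ↥(⨆ i, tangentSpace (grassmannian K r n) (![U.point, U'.point] i)) =
      (Finset.univ.filter (Near I) ∪ Finset.univ.filter (Near I')).card := by
  have h1 : (⨆ i, tangentSpace (grassmannian K r n)
      ((![U.point, U'.point] : Fin 2 → grassmannian K r n) i)) =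
      tangentSpace (grassmannian K r n) U.point ⊔ tangentSpace (grassmannian K r n) U'.point := by
    refine le_antisymm (iSup_le fun i => ?_) (sup_le ?_ ?_)
    · fin_cases i
      · exact le_sup_left
      · exact le_sup_right
    · exact le_iSup (fun i => tangentSpace (grassmannian K r n)
        ((![U.point, U'.point] : Fin 2 → grassmannian K r n) i)) 0
    · exact le_iSup (fun i => tangentSpace (grassmannian K r n)
        ((![U.point, U'.point] : Fin 2 → grassmannian K r n) i)) 1
  rw [h1, tangentSpace_point U f I h, tangentSpace_point U' f I' h', ← Submodule.map_sup,
    LinearEquiv.finrank_map_eq, tangentVec_minorCone_eq_span, tangentVec_minorCone_eq_span,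
    ← Submodule.span_union, ← Set.image_union, ← Finset.coe_union]
  have hli := (Pi.basisFun K (Fin (r + 1) ↪o Fin (n + 1))).linearIndependent
  rw [← Finset.coe_image, finrank_span_finset_eq_card,
    Finset.card_image_of_injective _ (Module.Basis.injective _)]
  rw [Finset.coe_image]
  exact (hli.linearIndepOn (s := _)).id_image

/-- Two points of the Grassmannian satisfy the condition of the `2`-Terracini locus if and only if
the subspaces meet in codimension at most two. -/
theorem terracini_condition_iff [Infinite K] (hr : 1 ≤ r) (hrn : r + 2 ≤ n) (hn : 5 ≤ n)
    (U U' : Gr K r n) :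
    ((Module.finrank K ↥(⨆ i, tangentSpace (grassmannian K r n)
        ((![U.point, U'.point] : Fin 2 → grassmannian K r n) i)) : ℤ) - 1 <
      min (((2 : ℕ) : ℤ) * (dim (grassmannian K r n) : ℤ) + ((2 : ℕ) : ℤ) - 1)
        ((Fintype.card (Fin (r + 1) ↪o Fin (n + 1)) : ℤ) - 1)) ↔
      (Module.finrank K ↥(U.1 ⊓ U'.1) : ℤ) - 1 ≥ (r : ℤ) - 2 := by
  classical
  obtain ⟨f, I, I', h, h', hcard⟩ := exists_linearEquiv_coordinate U.1 U'.1 U.2 U'.2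
  rw [finrank_iSup_tangentSpace U U' f I I' h h', ← hcard]
  have hd := dim_grassmannian (K := K) I
  have hd' := dim_grassmannian (K := K) I'
  have hpos : ∀ L : Fin (r + 1) ↪o Fin (n + 1), 0 < (Finset.univ.filter (Near L)).card :=
    fun L => Finset.card_pos.mpr ⟨L, by simp [Near]⟩
  have h1 := hpos I
  have h2 := hpos I'
  have h3 := Finset.card_union_add_card_inter (Finset.univ.filter (Near I))
    (Finset.univ.filter (Near I'))
  rw [lt_min_iff]
  constructor
  · rintro ⟨hlt, -⟩
    -- If no `J` were near both, the union would have `2 * dim + 2` elements, the expected dimension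
    -- of the span of the cones.
    have h4 : 0 < (Finset.univ.filter (Near I) ∩ Finset.univ.filter (Near I')).card := by omega
    obtain ⟨J, hJ⟩ := Finset.card_pos.mp h4
    simp only [Finset.mem_inter, Finset.mem_filter, Finset.mem_univ, true_and] at hJ
    have := hJ.1.le_card_inter hJ.2
    omega
  · intro hge
    have h5 : r + 1 ≤ (supp I ∩ supp I').card + 2 := by omega
    obtain ⟨J, hJ⟩ := exists_near_near h5
    obtain ⟨J', hJ'⟩ := exists_not_near (by omega) (by omega) (by omega) h5
    have h4 : 0 < (Finset.univ.filter (Near I) ∩ Finset.univ.filter (Near I')).card :=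
      Finset.card_pos.mpr ⟨J, by simpa using hJ⟩
    -- `J'` is a coordinate direction missing from the span, which gives the bound by `N`.
    have h6 : (Finset.univ.filter (Near I) ∪ Finset.univ.filter (Near I')).card <
        Fintype.card (Fin (r + 1) ↪o Fin (n + 1)) :=
      Finset.card_lt_univ_of_notMem (x := J') (by simpa using hJ')
    constructor <;> omega

/-- In adapted coordinates, equal points make `e_I` and `e_I'` proportional, forcing `I = I'`. -/
theorem point_injective : Function.Injective (Gr.point : Gr K r n → grassmannian K r n) := by
  intro U U' hUU'
  obtain ⟨f, I, I', h, h', -⟩ := exists_linearEquiv_coordinate U.1 U'.1 U.2 U'.2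
  obtain ⟨c, hc, hrep⟩ := exists_rep_point U f I h
  obtain ⟨c', hc', hrep'⟩ := exists_rep_point U' f I' h'
  rw [hUU', hrep', ← map_smul, ← map_smul] at hrep
  have h1 := congrFun ((pluckerAction (r + 1) f).injective hrep) I
  have h2 : I = I' := by
    by_contra hne
    simp [Pi.single_eq_of_ne hne, hc.symm] at h1
  subst h2
  exact Subtype.ext (h.symm.trans h')

theorem terraciniOpen_grassmannian [Infinite K] (hr : 1 ≤ r) (hrn : r + 2 ≤ n) (hn : 5 ≤ n) :
    terraciniOpen 2 (grassmannian K r n) =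
      {p : SymProd 2 (grassmannian K r n) |
        ∃ U U' : Gr K r n, p = SymProd.mk ![U.point, U'.point] ∧ U ≠ U' ∧
          (Module.finrank K ↥(U.1 ⊓ U'.1) : ℤ) - 1 ≥ (r : ℤ) - 2} := by
  ext p
  constructor
  · rintro ⟨x, rfl, hinj, hlt⟩
    have hpt : ∀ y : grassmannian K r n, ∃ U : Gr K r n, U.point = y := by
      rintro ⟨_, U, rfl⟩
      exact ⟨U, rfl⟩
    obtain ⟨U, hU⟩ := hpt (x 0)
    obtain ⟨U', hU'⟩ := hpt (x 1)
    have hx : x = ![U.point, U'.point] := by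
      funext i
      fin_cases i
      · exact hU.symm
      · exact hU'.symm
    subst hx
    refine ⟨U, U', rfl, ?_, (terracini_condition_iff hr hrn hn U U').mp hlt⟩
    rintro rfl
    exact zero_ne_one (hinj (a₁ := 0) (a₂ := 1) rfl)
  · rintro ⟨U, U', rfl, hne, hge⟩
    refine ⟨_, rfl, ?_, (terracini_condition_iff hr hrn hn U U').mpr hge⟩
    intro i j hij
    have hne' : U.point ≠ U'.point := fun h => hne (point_injective h)
    fin_cases i <;> fin_cases j
    · rfl
    · exact absurd hij hne'
    · exact absurd hij hne'.symm
    · rfl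

end Main

end Terracini

end

theorem proposition4p6 {K : Type*} [Field K] [IsAlgClosed K] (r n : ℕ)
    (hr : 1 ≤ r) (hrn : r + 2 ≤ n) (hn : 5 ≤ n) :
    Terracini.terraciniLocus 2 (Terracini.grassmannian K r n) =
      closure {p : Terracini.SymProd 2 (Terracini.grassmannian K r n) |
        ∃ U U' : Terracini.Gr K r n, p = Terracini.SymProd.mk ![U.point, U'.point] ∧ U ≠ U' ∧
          (Module.finrank K ↥(U.1 ⊓ U'.1) : ℤ) - 1 ≥ (r : ℤ) - 2} := by
  have : Infinite K := IsAlgClosed.instInfinite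
  rw [Terracini.terraciniLocus, Terracini.terraciniOpen_grassmannian hr hrn hn]
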